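/- Let $a,b\in\mathbb C$, and let $\sqrt{\cdot}$ denote the principal square root. (i) For each choice of the sign $\pm$, $$\max_{\theta\in[-\pi,\pi]}\left|a\cos\theta\pm\sqrt{b^2-a^2\sin^2\theta}\right|=\max\{|a+b|,|a-b|\}.$$ (ii) For $N\ge 2$ let $\mathcal T_{1d}=\mathcal T_{1d}(N)\in\mathbb C^{2(N-1)\times 2(N-1)}$ be the block tridiagonal Toeplitz matrix with $2\times 2$ blocks $A_0=\begin{pmatrix}0&b\\b&0\end{pmatrix}$ on the diagonal, $A_1=\begin{pmatrix}a&0\\0&0\end{pmatrix}$ on the block superdiagonal and $A_{-1}=\begin{pmatrix}0&0\\0&a\end{pmatrix}$ on the block subdiagonal; with the $a,b$ of (iii) and $\zeta=\sqrt{ik\sigma-k^2}$, $k,\sigma>0$, this is the iteration matrix of the parallel Schwarz method with $N$ subdomains for the operator $-\partial_{xx}+(ik\sigma-k^2)$ with impedance parameter $\alpha$, overlap $2\delta$ and subdomain length $L+2\delta$. Then the limit $R_{1d}:=\lim_{N\to\infty}\rho(\mathcal T_{1d})$ of the spectral radii exists, and $$R_{1d}\le\begin{cases}\max\{|a+b|,|a-b|\}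 & \text{if } |a^2-\tfrac12 b^2|^{1/2}\ge|a|,\\ \max\{|a+b|,|a-b|,|a|\} & \text{if } |a^2-\tfrac12 b^2|^{1/2}<|a|.\end{cases}$$ (iii) Let $\delta,L>0$, let $\zeta\in\mathbb C$ have positive real and imaginary parts (for example $\zeta=\sqrt{ik\sigma-k^2}$ with $k,\sigma>0$), let $\alpha\in\mathbb C$ with $\zeta+\alpha\ne0$, and suppose that $$D=(\zeta+\alpha)^2e^{\zeta(2\delta+L)}-(\zeta-\alpha)^2e^{-\zeta(2\delta+L)}\neq0,$$ $$a=\frac{(\zeta+\alpha)^2e^{2\zeta\delta}-(\zeta-\alpha)^2e^{-2\zeta\delta}}{D},\qquad b=-\frac{(\zeta^2-\alpha^2)(e^{\zeta L}-e^{-\zeta L})}{D}.$$ Put $z=2\delta\zeta=x+iy$ with $x,y$ real, $l=\frac{L}{2\delta}$, $\gamma=2\delta\alpha$, $v=\frac{z-\gamma}{z+\gamma}$, and $$g_\pm=(e^{2lx}-1)(e^{2x}-|v|^2)\pm4\sin(ly)\,(\operatorname{Im}v\cos y-\operatorname{Re}v\sin y)\,e^{x(l+1)},$$ $$g=(e^{2lx}-1)(e^{2x(l+2)}-|v|^4)+4\sin(ly)\left[((\operatorname{Re}v)^2-(\operatorname{Im}v)^2)\sin(y(l+2))-2\operatorname{Re}v\operatorname{Im}v\cos(y(l+2))\right]e^{2x(l+1)}.$$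 If $g_+>0$ and $g_->0$, then $\max\{|a+b|,|a-b|\}<1$. If $g>0$, then $|a|<1$. -/

import Mathlib

open Filter Topology

noncomputable section

/-- The `2m × 2m` block tridiagonal Toeplitz matrix with `2 × 2` blocks
`A₀ = [[0, b], [b, 0]]` on the diagonal, `A₁ = [[a, 0], [0, 0]]` above it and
`A₋₁ = [[0, 0], [0, a]]` below it. The index `(i, r)` is row `r` of block row `i`. -/
def blockToeplitz (a b : ℂ) (m : ℕ) : Matrix (Fin m × Fin 2) (Fin m × Fin 2) ℂ :=
  fun p q =>
    if q.1 = p.1 then !![0, b; b, 0] p.2 q.2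
    else if (q.1 : ℕ) = (p.1 : ℕ) + 1 then !![a, 0; 0, 0] p.2 q.2
    else if (p.1 : ℕ) = (q.1 : ℕ) + 1 then !![0, 0; 0, a] p.2 q.2
    else 0

/-- The iteration matrix of the parallel Schwarz method with `N` subdomains, acting on the
interface data `[R₊(b₁), R₋(a₂), R₊(b₂), …, R₊(b_{N-1}), R₋(a_N)]`, where
`R₋(a_j) ↦ a R₋(a_{j-1}) + b R₊(b_{j-1})` and `R₊(b_j) ↦ b R₋(a_{j+1}) + a R₊(b_{j+1})`,
with `R₋(a₁) = R₊(b_N) = 0`. The `N - 1` blocks are the pairs `(R₊(b_j), R₋(a_{j+1}))`. -/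
def schwarzMatrix (a b : ℂ) (N : ℕ) :
    Matrix (Fin (N - 1) × Fin 2) (Fin (N - 1) × Fin 2) ℂ :=
  blockToeplitz a b (N - 1)

/-- The common denominator of the two coefficients; it is (up to a non-zero factor) the
determinant of the local Robin problem on an interval of length `L + 2δ`, so it is non-zero
exactly when the local problems are well-posed. -/
def schwarzDenom (ζ α : ℂ) (δ L : ℝ) : ℂ :=
  (ζ + α) ^ 2 * Complex.exp (ζ * (2 * δ + L)) - (ζ - α) ^ 2 * Complex.exp (-(ζ * (2 * δ + L)))

/-- The coefficient `a` of the iteration matrix. -/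
def schwarzA (ζ α : ℂ) (δ L : ℝ) : ℂ :=
  ((ζ + α) ^ 2 * Complex.exp (2 * ζ * δ) - (ζ - α) ^ 2 * Complex.exp (-(2 * ζ * δ)))
    / schwarzDenom ζ α δ L

/-- The coefficient `b` of the iteration matrix. -/
def schwarzB (ζ α : ℂ) (δ L : ℝ) : ℂ :=
  -((ζ ^ 2 - α ^ 2) * (Complex.exp (ζ * L) - Complex.exp (-(ζ * L)))) / schwarzDenom ζ α δ L

/-- `v = (z - γ) / (z + γ)`. -/
def cayleyV (z γ : ℂ) : ℂ := (z - γ) / (z + γ)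

/-- The functions `g₊` (for `s = 1`) and `g₋` (for `s = -1`). -/
def gPM (s : ℝ) (z γ : ℂ) (l : ℝ) : ℝ :=
  let x := z.re
  let y := z.im
  let v := cayleyV z γ
  (Real.exp (2 * l * x) - 1) * (Real.exp (2 * x) - ‖v‖ ^ 2)
    + s * (4 * Real.sin (l * y) * (v.im * Real.cos y - v.re * Real.sin y)
        * Real.exp (x * (l + 1)))

/-- The function `g`. -/
def gA (z γ : ℂ) (l : ℝ) : ℝ :=
  let x := z.re
  let y := z.im
  let v := cayleyV z γ
  (Real.exp (2 * l * x) - 1) * (Real.exp (2 * x * (l + 2)) - ‖v‖ ^ 4)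
    + 4 * Real.sin (l * y)
      * ((v.re ^ 2 - v.im ^ 2) * Real.sin (y * (l + 2))
          - 2 * v.re * v.im * Real.cos (y * (l + 2)))
      * Real.exp (2 * x * (l + 1))

end

/-! Write M for max(|a+b|, |a-b|), the norm of the circulant C = [[a, b], [b, a]], whose orthogonal
eigenvectors are (1, ±1). With the second component shifted by one site, the block Toeplitz matrix
applies C at each of m + 1 sites and drops two boundary outputs, so every eigenvalue has modulus at
most M (`norm_le_of_mem_spectrum_blockToeplitz`). The symbol is C up to a unimodular diagonal
factor, which bounds the curve in (i); θ = 0 and θ = π attain the bound. For b ≠ 0 the bound is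
sharp in the limit: sine eigenvectors with θ close to π/m give eigenvalues tending to a + c for
either c = ±b (`exists_tendsto_mem_spectrum_blockToeplitz`), so the spectral radii tend to M. For b
= 0 all eigenvalues vanish and the limit is 0. Hence R ≤ M in both cases of (ii). For (iii), a + b,
a - b and a are quotients, and g₋, g₊ and g respectively are |denominator|² - |numerator|². -/

/-! ### The circulant bound and the symbol curve -/

/-- The matrix `[[a, b], [b, a]]` has norm `max ‖a + b‖ ‖a - b‖`. -/
lemma norm_sq_symm_circulant_le (a b p q : ℂ) :
    ‖a * p + b * q‖ ^ 2 + ‖b * p + a * q‖ ^ 2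
      ≤ (max ‖a + b‖ ‖a - b‖) ^ 2 * (‖p‖ ^ 2 + ‖q‖ ^ 2) := by
  have h1 := parallelogram_law_with_norm ℝ (a * p + b * q) (b * p + a * q)
  have h2 := parallelogram_law_with_norm ℝ p q
  have e1 : a * p + b * q + (b * p + a * q) = (a + b) * (p + q) := by ring
  have e2 : a * p + b * q - (b * p + a * q) = (a - b) * (p - q) := by ring
  rw [e1, e2, norm_mul, norm_mul] at h1
  have h3 : ‖a + b‖ ^ 2 ≤ (max ‖a + b‖ ‖a - b‖) ^ 2 := by gcongr; exact le_max_left _ _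
  have h4 : ‖a - b‖ ^ 2 ≤ (max ‖a + b‖ ‖a - b‖) ^ 2 := by gcongr; exact le_max_right _ _
  have h5 := mul_le_mul_of_nonneg_right h3 (sq_nonneg ‖p + q‖)
  have h6 := mul_le_mul_of_nonneg_right h4 (sq_nonneg ‖p - q‖)
  nlinarith

/-- Points of the curve swept out by the eigenvalues of the symbol are bounded by
`max ‖a + b‖ ‖a - b‖`. -/
lemma norm_le_of_symbol_eigenvalue {a b lam : ℂ} (θ : ℝ)
    (h : (lam - a * Complex.cos θ) ^ 2 = b ^ 2 - a ^ 2 * Complex.sin θ ^ 2) :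
    ‖lam‖ ≤ max ‖a + b‖ ‖a - b‖ := by
  set z : ℂ := Complex.exp (θ * Complex.I) with hz
  set z' : ℂ := Complex.exp (-θ * Complex.I) with hz'
  have hzz : z * z' = 1 := by rw [hz, hz', ← Complex.exp_add]; simp
  have hcos : 2 * Complex.cos θ = z + z' := by rw [Complex.cos]; ring
  have hn : ‖z‖ = 1 := Complex.norm_exp_ofReal_mul_I θ
  have hn' : ‖z'‖ = 1 := by
    have := congrArg norm hzz
    rwa [norm_mul, hn, one_mul, norm_one] at this
  have hdet : (lam - a * z) * (lam - a * z') = b ^ 2 := by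
    have hs := Complex.sin_sq_add_cos_sq (θ : ℂ)
    linear_combination h + a * lam * hcos + a ^ 2 * hzz - a ^ 2 * hs
  by_cases hb : b = 0
  · subst hb
    rcases mul_eq_zero.1 (hdet.trans (by simp)) with h | h <;>
    · rw [sub_eq_zero.1 h]; simp [hn, hn']
  -- The dispersion relation makes C send (z b, lam - a z) to lam (b, z (lam - a z)). Since |z| = 1,
  -- this scales the norm by exactly |lam|. The vector is nonzero because b ≠ 0.
  · have key := norm_sq_symm_circulant_le a b (z * b) (lam - a * z)
    have e1 : a * (z * b) + b * (lam - a * z) = lam * b := by ring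
    have e2 : b * (z * b) + a * (lam - a * z) = z * (lam * (lam - a * z)) := by
      linear_combination (-z) * hdet - a * (lam - a * z) * hzz
    rw [e1, e2] at key
    simp only [norm_mul, hn, one_mul, mul_pow] at key
    have hpos : 0 < ‖b‖ ^ 2 + ‖lam - a * z‖ ^ 2 := by positivity
    refine (sq_le_sq₀ (norm_nonneg _) (by positivity)).1 ?_
    refine le_of_mul_le_mul_right ?_ hpos
    linarith

lemma Complex.sqrt_sq (w : ℂ) : Complex.sqrt w ^ 2 = w := by
  simp [Complex.sqrt]

lemma isGreatest_norm_symbol_eigenvalue (a b s : ℂ) (hs : s = 1 ∨ s = -1) :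
    IsGreatest
      ((fun θ : ℝ => ‖a * Complex.cos θ
          + s * Complex.sqrt (b ^ 2 - a ^ 2 * Complex.sin θ ^ 2)‖) ''
        Set.Icc (-Real.pi) Real.pi)
      (max ‖a + b‖ ‖a - b‖) := by
  have hs2 : s ^ 2 = 1 := by rcases hs with rfl | rfl <;> norm_num
  constructor
  · have hpi := Real.pi_pos
    -- Whichever root of b² is selected, θ = 0 and θ = π together produce both |a + b| and |a - b|.
    have hr : s * Complex.sqrt (b ^ 2) = b ∨ s * Complex.sqrt (b ^ 2) = -b := by
      apply sq_eq_sq_iff_eq_or_eq_neg.1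
      rw [mul_pow, hs2, Complex.sqrt_sq, one_mul]
    have h0 : ‖a + s * Complex.sqrt (b ^ 2)‖ ∈ ((fun θ : ℝ => ‖a * Complex.cos θ
          + s * Complex.sqrt (b ^ 2 - a ^ 2 * Complex.sin θ ^ 2)‖) ''
        Set.Icc (-Real.pi) Real.pi) := ⟨0, ⟨by linarith, hpi.le⟩, by simp⟩
    have h1 : ‖a - s * Complex.sqrt (b ^ 2)‖ ∈ ((fun θ : ℝ => ‖a * Complex.cos θ
          + s * Complex.sqrt (b ^ 2 - a ^ 2 * Complex.sin θ ^ 2)‖) ''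
        Set.Icc (-Real.pi) Real.pi) := by
      refine ⟨Real.pi, ⟨by linarith, le_rfl⟩, ?_⟩
      simp only [Complex.cos_pi, Complex.sin_pi]
      rw [← norm_neg]
      congr 1
      simp only [ne_eq, OfNat.ofNat_ne_zero, not_false_eq_true, zero_pow, mul_zero, sub_zero]
      ring
    rcases hr with hr | hr <;> rw [hr] at h0 h1 <;> rcases max_choice ‖a + b‖ ‖a - b‖ with h | h
    · rwa [h]
    · rwa [h]
    · rw [h]; simpa using h1
    · rw [h]; simpa [sub_eq_add_neg] using h0
  · rintro _ ⟨θ, -, rfl⟩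
    apply norm_le_of_symbol_eigenvalue θ
    rw [add_sub_cancel_left, mul_pow, hs2, Complex.sqrt_sq, one_mul]

/-! ### The eigenvalue problem on grid functions -/

lemma Matrix.mem_spectrum_iff_exists_mulVec {n : Type*} [Fintype n] [DecidableEq n]
    (A : Matrix n n ℂ) (lam : ℂ) :
    lam ∈ spectrum ℂ A ↔ ∃ x : n → ℂ, x ≠ 0 ∧ A.mulVec x = lam • x := by
  rw [← Matrix.spectrum_toLin', ← Module.End.hasEigenvalue_iff_mem_spectrum]
  constructor
  · intro h
    obtain ⟨x, hx⟩ := h.exists_hasEigenvector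
    exact ⟨x, hx.2, by simpa using hx.apply_eq_smul⟩
  · rintro ⟨x, hx, h⟩
    exact Module.End.hasEigenvalue_of_hasEigenvector
      (Module.End.hasEigenvector_iff.2 ⟨Module.End.mem_eigenspace_iff.2 (by simpa using h), hx⟩)

/-- The grid function whose component `0` is `u` and whose component `1` is `w` shifted by one. -/
def gridVec (u w : ℕ → ℂ) (m : ℕ) : Fin m × Fin 2 → ℂ :=
  fun p => if p.2 = 0 then u p.1 else w (p.1 + 1)

lemma Fin.sum_ite_val_eq {m : ℕ} (f : ℕ → ℂ) (k : ℕ) (hk : m ≤ k → f k = 0) :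
    ∑ j : Fin m, (if (j : ℕ) = k then f j else 0) = f k := by
  rw [Fin.sum_univ_eq_sum_range (fun j => if j = k then f j else 0), Finset.sum_ite_eq']
  split_ifs with h
  · rfl
  · exact (hk (by simpa using h)).symm

lemma blockToeplitz_mulVec_zero (a b : ℂ) {m : ℕ} {u : ℕ → ℂ} (w : ℕ → ℂ) (hu : u m = 0)
    (i : Fin m) :
    (blockToeplitz a b m).mulVec (gridVec u w m) (i, 0) = a * u (i + 1) + b * w (i + 1) := by
  rw [← Fin.sum_ite_val_eq (m := m) (fun j => a * u j) (i + 1), ←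
    Fin.sum_ite_val_eq (m := m) (fun j => b * w (j + 1)) i, ← Finset.sum_add_distrib]
  · simp only [Matrix.mulVec, dotProduct, Fintype.sum_prod_type, Fin.sum_univ_two]
    refine Finset.sum_congr rfl fun j _ => ?_
    have hji : (j = i) = ((j : ℕ) = i) := propext Fin.ext_iff
    simp only [blockToeplitz, gridVec, hji]
    split_ifs <;> first | omega | simp
  · intro h; omega
  · intro h
    rw [show (i : ℕ) + 1 = m by omega, hu, mul_zero]

lemma blockToeplitz_mulVec_one (a b : ℂ) {m : ℕ} (u : ℕ → ℂ) {w : ℕ → ℂ} (hw : w 0 = 0)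
    (i : Fin m) :
    (blockToeplitz a b m).mulVec (gridVec u w m) (i, 1) = b * u i + a * w i := by
  have hwi : ∑ j : Fin m, (if (i : ℕ) = j + 1 then a * w (j + 1) else 0) = a * w i := by
    rcases Nat.eq_zero_or_pos (i : ℕ) with h | h
    · simp [h, hw]
    · have := Fin.sum_ite_val_eq (m := m) (fun j => a * w (j + 1)) (i - 1) (fun h => by omega)
      rw [Nat.sub_add_cancel h] at this
      rw [← this]
      refine Finset.sum_congr rfl fun j _ => ?_
      congr 1
      apply propext; omega
  rw [← hwi, ← Fin.sum_ite_val_eq (m := m) (fun j => b * u j) i, ← Finset.sum_add_distrib]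
  · simp only [Matrix.mulVec, dotProduct, Fintype.sum_prod_type, Fin.sum_univ_two]
    refine Finset.sum_congr rfl fun j _ => ?_
    have hji : (j = i) = ((j : ℕ) = i) := propext Fin.ext_iff
    simp only [blockToeplitz, gridVec, hji]
    split_ifs <;> first | omega | simp
  · intro h; omega

/-- Eigenvalues of `blockToeplitz` in terms of grid functions. -/
lemma mem_spectrum_blockToeplitz_iff (a b : ℂ) (m : ℕ) (lam : ℂ) :
    lam ∈ spectrum ℂ (blockToeplitz a b m) ↔
      ∃ u w : ℕ → ℂ, u m = 0 ∧ w 0 = 0 ∧ (∃ i < m, u i ≠ 0 ∨ w (i + 1) ≠ 0) ∧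
        ∀ i < m, a * u (i + 1) + b * w (i + 1) = lam * u i ∧
          b * u i + a * w i = lam * w (i + 1) := by
  rw [Matrix.mem_spectrum_iff_exists_mulVec]
  constructor
  · rintro ⟨x, hx, h⟩
    set u : ℕ → ℂ := fun i => if hi : i < m then x (⟨i, hi⟩, 0) else 0 with hu
    -- The clause `i ≠ 0` encodes the boundary value w 0 = 0, since truncated subtraction would
    -- otherwise read block 0.
    set w : ℕ → ℂ := fun i => if hi : i - 1 < m ∧ i ≠ 0 then x (⟨i - 1, hi.1⟩, 1) else 0 with hw
    have hum : u m = 0 := by simp [hu]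
    have hw0 : w 0 = 0 := by simp [hw]
    have hxe : x = gridVec u w m := by
      funext ⟨i, r⟩
      fin_cases r <;> simp [gridVec, hu, hw]
    refine ⟨u, w, hum, hw0, ?_, fun i hi => ⟨?_, ?_⟩⟩
    · by_contra! hc
      apply hx
      rw [hxe]
      funext ⟨i, r⟩
      fin_cases r <;> simp [gridVec, hc i i.2]
    · have := congrFun h (⟨i, hi⟩, 0)
      rw [hxe, blockToeplitz_mulVec_zero a b w hum] at this
      simpa [gridVec] using this
    · have := congrFun h (⟨i, hi⟩, 1)
      rw [hxe, blockToeplitz_mulVec_one a b u hw0] at this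
      simpa [gridVec] using this
  · rintro ⟨u, w, hum, hw0, ⟨i, hi, hne⟩, h⟩
    refine ⟨gridVec u w m, fun h0 => ?_, ?_⟩
    · have h1 := congrFun h0 (⟨i, hi⟩, 0)
      have h2 := congrFun h0 (⟨i, hi⟩, 1)
      simp [gridVec] at h1 h2
      tauto
    · funext ⟨i, r⟩
      fin_cases r
      · simpa [gridVec] using
          (blockToeplitz_mulVec_zero a b w hum i).trans (h i i.2).1
      · simpa [gridVec] using
          (blockToeplitz_mulVec_one a b u hw0 i).trans (h i i.2).2

/-- Both outputs at a site depend only on the pair (u i, w i), through C. Padding with u m = w 0 = 0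
gives m + 1 sites of the same total norm, so the circulant bound can be summed. -/
lemma norm_le_of_mem_spectrum_blockToeplitz {a b : ℂ} {m : ℕ} {lam : ℂ}
    (h : lam ∈ spectrum ℂ (blockToeplitz a b m)) : ‖lam‖ ≤ max ‖a + b‖ ‖a - b‖ := by
  obtain ⟨u, w, hum, hw0, ⟨k, hk, hne⟩, h⟩ := (mem_spectrum_blockToeplitz_iff a b m lam).1 h
  set M := max ‖a + b‖ ‖a - b‖
  set S := ∑ i ∈ Finset.range m, (‖u i‖ ^ 2 + ‖w (i + 1)‖ ^ 2) with hS
  have hSpos : 0 < S := by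
    refine Finset.sum_pos' (fun i _ => by positivity) ⟨k, by simpa using hk, ?_⟩
    rcases hne with h | h <;> positivity
  have hS' : ∑ i ∈ Finset.range (m + 1), (‖u i‖ ^ 2 + ‖w i‖ ^ 2) = S := by
    rw [Finset.sum_add_distrib, hS, Finset.sum_add_distrib, Finset.sum_range_succ,
      Finset.sum_range_succ' (fun i => ‖w i‖ ^ 2)]
    simp [hum, hw0]
  have key : ‖lam‖ ^ 2 * S ≤ M ^ 2 * S := by
    calc ‖lam‖ ^ 2 * S
        = ∑ i ∈ Finset.range m, (‖a * u (i + 1) + b * w (i + 1)‖ ^ 2 + ‖b * u i + a * w i‖ ^ 2) := by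
          rw [hS, Finset.mul_sum]
          refine Finset.sum_congr rfl fun i hi => ?_
          rw [(h i (by simpa using hi)).1, (h i (by simpa using hi)).2, norm_mul, norm_mul]
          ring
      -- The two added terms, the first output at site 0 and the second at site m, are not rows of
      -- the matrix.
      _ ≤ ∑ i ∈ Finset.range (m + 1), (‖a * u i + b * w i‖ ^ 2 + ‖b * u i + a * w i‖ ^ 2) := by
          rw [Finset.sum_add_distrib, Finset.sum_add_distrib,
            Finset.sum_range_succ' (fun i => ‖a * u i + b * w i‖ ^ 2),
            Finset.sum_range_succ (fun i => ‖b * u i + a * w i‖ ^ 2)]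
          have := sq_nonneg ‖a * u 0 + b * w 0‖
          have := sq_nonneg ‖b * u m + a * w m‖
          linarith
      _ ≤ ∑ i ∈ Finset.range (m + 1), M ^ 2 * (‖u i‖ ^ 2 + ‖w i‖ ^ 2) :=
          Finset.sum_le_sum fun i _ => norm_sq_symm_circulant_le a b (u i) (w i)
      _ = M ^ 2 * S := by rw [← Finset.mul_sum, hS']
  exact (sq_le_sq₀ (norm_nonneg _) (by positivity)).1 (le_of_mul_le_mul_right key hSpos)

/-- Without b the components decouple into nilpotent shifts: a nonzero eigenvalue would propagate u
m = 0 downwards and w 0 = 0 upwards. -/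
lemma eq_zero_of_mem_spectrum_blockToeplitz_zero {a : ℂ} {m : ℕ} {lam : ℂ}
    (h : lam ∈ spectrum ℂ (blockToeplitz a 0 m)) : lam = 0 := by
  obtain ⟨u, w, hum, hw0, ⟨k, hk, hne⟩, h⟩ := (mem_spectrum_blockToeplitz_iff a 0 m lam).1 h
  by_contra hlam
  have hu : ∀ j ≤ m, u (m - j) = 0 := by
    intro j
    induction j with
    | zero => simpa using hum
    | succ j ih =>
      intro hj
      have := (h (m - (j + 1)) (by omega)).1
      rw [show m - (j + 1) + 1 = m - j by omega, ih (by omega)] at this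
      simpa [hlam] using this.symm
  have hw : ∀ j ≤ m, w j = 0 := by
    intro j
    induction j with
    | zero => simpa using hw0
    | succ j ih =>
      intro hj
      have := (h j (by omega)).2
      rw [ih (by omega)] at this
      simpa [hlam] using this.symm
  rcases hne with hne | hne
  · exact hne (by simpa [Nat.sub_sub_self hk.le] using hu (m - k) (by omega))
  · exact hne (hw _ hk)

/-! ### Eigenvalues converging to a ± b -/

/-- The discrete dispersion relation: sine eigenvectors. -/
lemma mem_spectrum_blockToeplitz_of_dispersion {a b lam θ : ℂ} {m : ℕ} (hm : 0 < m) (hb : b ≠ 0)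
    (hθ : Complex.sin θ ≠ 0)
    (hdisp : (lam - a * Complex.cos θ) ^ 2 = b ^ 2 - a ^ 2 * Complex.sin θ ^ 2)
    (hquant : lam * Complex.sin ((m + 1) * θ) = a * Complex.sin (m * θ)) :
    lam ∈ spectrum ℂ (blockToeplitz a b m) := by
  rw [mem_spectrum_blockToeplitz_iff]
  set u : ℕ → ℂ := fun i => Complex.sin ((m - i) * θ) with hu
  have hrec : ∀ i : ℕ, Complex.sin ((m - i + 1) * θ) + u (i + 1) = 2 * Complex.cos θ * u i := by
    intro i
    have e1 : ((m : ℂ) - i + 1) * θ = (m - i) * θ + θ := by ring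
    have e2 : ((m : ℂ) - (i + 1 : ℕ)) * θ = (m - i) * θ - θ := by push_cast; ring
    simp only [hu]
    rw [e1, e2, Complex.sin_add, Complex.sin_sub]
    ring
  have hs := Complex.sin_sq_add_cos_sq θ
  have hP : lam ^ 2 + a ^ 2 - b ^ 2 = 2 * a * lam * Complex.cos θ := by
    linear_combination hdisp - a ^ 2 * hs
  -- The first row equation determines w. The second then follows from the sine recurrence and `hP`,
  -- except at i = 0, where w 0 = 0 requires `hquant`.
  set w : ℕ → ℂ := fun i => if i = 0 then 0 else (lam * u (i - 1) - a * u i) / b with hw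
  have hws : ∀ i, b * w (i + 1) = lam * u i - a * u (i + 1) := by
    intro i
    simp only [hw, Nat.add_eq_zero_iff, one_ne_zero, and_false, if_false, Nat.add_sub_cancel]
    field_simp
  refine ⟨u, w, by simp [hu], by simp [hw], ⟨m - 1, by omega, Or.inl ?_⟩, fun i hi => ⟨?_, ?_⟩⟩
  · simpa [hu, Nat.cast_sub (Nat.one_le_iff_ne_zero.2 hm.ne')] using hθ
  · rw [hws]; ring
  · apply mul_left_cancel₀ hb
    have hr := hrec i
    rcases Nat.eq_zero_or_pos i with rfl | hi0
    · have hq : lam * Complex.sin ((m - (0 : ℕ) + 1) * θ) = a * u 0 := by simpa [hu] using hquant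
      have h0 := hws 0
      have hw0 : w 0 = 0 := by simp [hw]
      rw [hw0]
      linear_combination (-lam) * h0 + a * lam * hr - a * hq - u 0 * hP
    · obtain ⟨j, rfl⟩ := Nat.exists_eq_succ_of_ne_zero hi0.ne'
      have h0 := hws (j + 1)
      have h1 := hws j
      have hj : Complex.sin ((m - ((j + 1 : ℕ) : ℂ) + 1) * θ) = u j := by
        simp only [hu]; congr 1; push_cast; ring
      rw [Nat.succ_eq_add_one] at *
      rw [hj] at hr
      linear_combination (-lam) * h0 + a * h1 + a * lam * hr - u (j + 1) * hP

/-- A smooth branch of the eigenvalue curve of the symbol through `a + c`, where `c = ± b`. -/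
lemma exists_smooth_symbol_eigenvalue {a b c : ℂ} (hb : b ≠ 0) (hc : c ^ 2 = b ^ 2) :
    ∃ μ : ℂ → ℂ, ContDiffAt ℂ 1 μ 0 ∧ μ 0 = a + c ∧
      ∀ᶠ θ in 𝓝 0, (μ θ - a * Complex.cos θ) ^ 2 = b ^ 2 - a ^ 2 * Complex.sin θ ^ 2 := by
  -- The radicand is b² q with q 0 = 1, so exp(log q / 2) is a smooth root near 0, unlike the
  -- principal root of the radicand, which may meet its cut.
  set q : ℂ → ℂ := fun θ => 1 - (a / b) ^ 2 * Complex.sin θ ^ 2 with hq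
  have hqd : ContDiff ℂ 1 q := by fun_prop
  have hq0 : q 0 = 1 := by simp [hq]
  refine ⟨fun θ => a * Complex.cos θ + c * Complex.exp (Complex.log (q θ) / 2), ?_, ?_, ?_⟩
  · have hl : ContDiffAt ℂ 1 (fun θ => Complex.log (q θ)) 0 :=
      (Complex.contDiffAt_log (by rw [hq0]; exact Complex.one_mem_slitPlane)).comp 0 hqd.contDiffAt
    have : ContDiffAt ℂ 1 Complex.cos 0 := Complex.contDiff_cos.contDiffAt
    exact (contDiffAt_const.mul this).add (contDiffAt_const.mul (hl.div_const 2).cexp)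
  · simp [hq0]
  · have : ∀ᶠ θ in 𝓝 0, q θ ≠ 0 := hqd.continuous.continuousAt.eventually_ne (by simp [hq0])
    filter_upwards [this] with θ hθ
    rw [add_sub_cancel_left, mul_pow, ← Complex.exp_nat_mul, hc]
    rw [show ((2 : ℕ) : ℂ) * (Complex.log (q θ) / 2) = Complex.log (q θ) by push_cast; ring,
      Complex.exp_log hθ]
    simp only [hq]
    field_simp

/-- Put θ = φ/m and ε = 1/m. The quantisation condition becomes F(ε, φ) = 0, and F(0, φ) = c sin φ
has a simple zero at φ = π. The implicit function theorem continues this zero to small ε, so θ tends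
to 0 and the eigenvalue to μ 0 = a + c. -/
lemma exists_tendsto_mem_spectrum_blockToeplitz (a : ℂ) {b c : ℂ} (hb : b ≠ 0)
    (hc : c ^ 2 = b ^ 2) :
    ∃ Λ : ℕ → ℂ, Tendsto Λ atTop (𝓝 (a + c)) ∧
      ∀ᶠ m in atTop, Λ m ∈ spectrum ℂ (blockToeplitz a b m) := by
  obtain ⟨μ, hμd, hμ0, hμ⟩ := exists_smooth_symbol_eigenvalue (a := a) hb hc
  have hc0 : c ≠ 0 := by
    rintro rfl
    exact hb (by simpa using hc.symm)
  set F : ℂ × ℂ → ℂ := fun p =>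
    μ (p.1 * p.2) * Complex.sin (p.2 + p.1 * p.2) - a * Complex.sin p.2 with hF
  have hFd : ContDiffAt ℂ 1 F (0, Real.pi) := by
    have h1 : ContDiffAt ℂ 1 (fun p : ℂ × ℂ => μ (p.1 * p.2)) (0, (Real.pi : ℂ)) := by
      apply ContDiffAt.comp (g := μ) (f := fun p : ℂ × ℂ => p.1 * p.2)
      · simpa using hμd
      · fun_prop
    have h2 : ContDiff ℂ 1 (fun p : ℂ × ℂ => Complex.sin (p.2 + p.1 * p.2)) := by fun_prop
    have h3 : ContDiff ℂ 1 (fun p : ℂ × ℂ => a * Complex.sin p.2) := by fun_prop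
    exact (h1.mul h2.contDiffAt).sub h3.contDiffAt
  have hst : HasStrictFDerivAt F (fderiv ℂ F (0, (Real.pi : ℂ))) (0, (Real.pi : ℂ)) :=
    hFd.hasStrictFDerivAt one_ne_zero
  have hpart : fderiv ℂ F (0, (Real.pi : ℂ)) (0, 1) = -c := by
    have h1 : HasDerivAt (fun φ : ℂ => F (0, φ)) (fderiv ℂ F (0, (Real.pi : ℂ)) (0, 1)) Real.pi :=
      hst.hasFDerivAt.comp_hasDerivAt _
        ((hasDerivAt_const _ _).prodMk (hasDerivAt_id _))
    have h2 : HasDerivAt (fun φ : ℂ => F (0, φ)) (c * Complex.cos Real.pi) Real.pi := by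
      have : (fun φ : ℂ => F (0, φ)) = fun φ => c * Complex.sin φ := by
        funext φ
        simp only [hF, zero_mul, add_zero, hμ0]
        ring
      rw [this]
      exact (Complex.hasDerivAt_sin _).const_mul c
    rw [h1.unique h2]
    simp
  have hinv : (fderiv ℂ F (0, (Real.pi : ℂ)) ∘L .inr ℂ ℂ ℂ).IsInvertible := by
    refine ⟨ContinuousLinearEquiv.unitsEquivAut ℂ (Units.mk0 (-c) (neg_ne_zero.2 hc0)), ?_⟩
    ext
    simp [hpart]
  set ψ := hst.implicitFunctionOfProdDomain hinv with hψ
  have hψt : Tendsto ψ (𝓝 0) (𝓝 (Real.pi : ℂ)) := hst.tendsto_implicitFunctionOfProdDomain hinv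
  have hψe : ∀ᶠ e in 𝓝 (0 : ℂ), F (e, ψ e) = 0 := by
    have := hst.eventually_apply_implicitFunctionOfProdDomain hinv
    simpa [hF] using this
  have hinvt : Tendsto (fun m : ℕ => ((m : ℂ))⁻¹) atTop (𝓝 0) := tendsto_inv_atTop_nhds_zero_nat
  have hφt : Tendsto (fun m : ℕ => ψ ((m : ℂ))⁻¹) atTop (𝓝 (Real.pi : ℂ)) := hψt.comp hinvt
  have hθt : Tendsto (fun m : ℕ => ((m : ℂ))⁻¹ * ψ ((m : ℂ))⁻¹) atTop (𝓝 0) := by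
    simpa using hinvt.mul hφt
  refine ⟨fun m => μ (((m : ℂ))⁻¹ * ψ ((m : ℂ))⁻¹), ?_, ?_⟩
  · rw [← hμ0]
    exact hμd.continuousAt.tendsto.comp hθt
  · have hpi : (Real.pi : ℂ) ≠ 0 := by exact_mod_cast Real.pi_ne_zero
    have hsin : ∀ᶠ θ in 𝓝[≠] (0 : ℂ), Complex.sin θ ≠ 0 := by
      have := (Complex.hasDerivAt_sin 0).eventually_ne (c := 0) (by simp)
      exact this
    -- Continuing from π rather than from the zero φ = 0 keeps θ ≠ 0, hence sin θ ≠ 0 and a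
    -- nontrivial eigenvector.
    have hθ0 : ∀ᶠ m : ℕ in atTop, ((m : ℂ))⁻¹ * ψ ((m : ℂ))⁻¹ ≠ 0 := by
      filter_upwards [hφt.eventually_ne hpi, eventually_gt_atTop 0] with m h1 h2
      exact mul_ne_zero (inv_ne_zero (by exact_mod_cast h2.ne')) h1
    have hθt' := tendsto_nhdsWithin_iff (s := {0}ᶜ).2 ⟨hθt, hθ0⟩
    filter_upwards [hθt'.eventually hsin, hθt.eventually hμ, hinvt.eventually hψe,
      eventually_gt_atTop 0] with m h1 h2 h3 hm
    have hm' : (m : ℂ) ≠ 0 := by exact_mod_cast hm.ne'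
    refine mem_spectrum_blockToeplitz_of_dispersion hm hb h1 h2 ?_
    have e1 : (m : ℂ) * (((m : ℂ))⁻¹ * ψ ((m : ℂ))⁻¹) = ψ ((m : ℂ))⁻¹ := by field_simp
    rw [add_mul, e1, one_mul]
    exact sub_eq_zero.1 h3

/-! ### The limit of the spectral radii -/

lemma exists_limit_spectralRadius_schwarzMatrix (a b : ℂ) :
    ∃ R : NNReal,
      Tendsto (fun N : ℕ => spectralRadius ℂ (schwarzMatrix a b N)) atTop (𝓝 (R : ENNReal)) ∧
      (R : ℝ) ≤ max ‖a + b‖ ‖a - b‖ := by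
  by_cases hb : b = 0
  · subst hb
    refine ⟨0, ?_, by positivity⟩
    have : ∀ N : ℕ, spectralRadius ℂ (schwarzMatrix a 0 N) = ((0 : NNReal) : ENNReal) := by
      intro N
      simp only [spectralRadius, schwarzMatrix, ENNReal.coe_zero, ENNReal.iSup_eq_zero]
      intro k hk
      simp [eq_zero_of_mem_spectrum_blockToeplitz_zero hk]
    simp only [this]
    exact tendsto_const_nhds
  · obtain ⟨c, hc, hM⟩ : ∃ c : ℂ, c ^ 2 = b ^ 2 ∧ max ‖a + b‖ ‖a - b‖ = ‖a + c‖ := by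
      rcases max_choice ‖a + b‖ ‖a - b‖ with h | h
      · exact ⟨b, rfl, h⟩
      · exact ⟨-b, by ring, by rw [h, sub_eq_add_neg]⟩
    refine ⟨‖a + c‖₊, ?_, by rw [hM, coe_nnnorm]⟩
    obtain ⟨Λ, hΛ, hmem⟩ := exists_tendsto_mem_spectrum_blockToeplitz a hb hc
    have hsub : Tendsto (fun N : ℕ => N - 1) atTop atTop := tendsto_sub_atTop_nat 1
    have hlow : Tendsto (fun N : ℕ => (‖Λ (N - 1)‖₊ : ENNReal)) atTop (𝓝 (‖a + c‖₊ : ENNReal)) :=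
      ENNReal.tendsto_coe.2 ((hΛ.comp hsub).nnnorm)
    refine tendsto_of_tendsto_of_tendsto_of_le_of_le' hlow tendsto_const_nhds ?_ ?_
    · filter_upwards [hsub.eventually hmem] with N hN
      exact le_iSup₂ (f := fun (k : ℂ) (_ : k ∈ spectrum ℂ (schwarzMatrix a b N)) =>
        (‖k‖₊ : ENNReal)) (Λ (N - 1)) hN
    · refine Eventually.of_forall fun N => iSup₂_le fun k hk => ?_
      have := norm_le_of_mem_spectrum_blockToeplitz hk
      rw [hM] at this
      exact_mod_cast this

/-! ### Coefficients of the Schwarz method -/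

lemma normSq_sub_normSq_mul_sub (E F v : ℂ) :
    Complex.normSq (E * F - v) - Complex.normSq (E - v * F)
      = (Complex.normSq F - 1) * (Complex.normSq E - Complex.normSq v)
        + 4 * F.im * (v.re * E.im - v.im * E.re) := by
  simp only [Complex.normSq_apply, Complex.sub_re, Complex.sub_im, Complex.mul_re, Complex.mul_im]
  ring

lemma normSq_sub_normSq_sq_sub (E F v : ℂ) :
    Complex.normSq ((E * F) ^ 2 - v ^ 2) - Complex.normSq (F * (E ^ 2 - v ^ 2))
      = (Complex.normSq F - 1) * (Complex.normSq E ^ 2 * Complex.normSq F - Complex.normSq v ^ 2)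
        + 4 * F.im * ((v.re ^ 2 - v.im ^ 2) * (E ^ 2 * F).im
          - 2 * v.re * v.im * (E ^ 2 * F).re) := by
  simp only [Complex.normSq_apply, Complex.sub_re, Complex.sub_im, Complex.mul_re, Complex.mul_im,
    pow_two]
  ring

/-- A positive gap also forces the denominator to be nonzero. -/
lemma norm_div_lt_one_of_normSq_lt {p q : ℂ} (h : 0 < Complex.normSq q - Complex.normSq p) :
    ‖p / q‖ < 1 := by
  rw [Complex.normSq_eq_norm_sq, Complex.normSq_eq_norm_sq] at h
  have h1 : ‖p‖ < ‖q‖ := lt_of_pow_lt_pow_left₀ 2 (norm_nonneg _) (by linarith)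
  rw [norm_div, div_lt_one ((norm_nonneg _).trans_lt h1)]
  exact h1

/-- The coefficients in terms of `E = exp z`, `F = exp (l z)` and `v`. -/
lemma schwarz_coefficients {ζ α : ℂ} {δ L : ℝ} (hδ : 0 < δ) (hα : ζ + α ≠ 0)
    (hD : schwarzDenom ζ α δ L ≠ 0) {E F v : ℂ} (hE : E = Complex.exp (2 * δ * ζ))
    (hF : F = Complex.exp ((L / (2 * δ) : ℝ) * (2 * δ * ζ)))
    (hv : v = cayleyV (2 * δ * ζ) (2 * δ * α)) :
    schwarzA ζ α δ L + schwarzB ζ α δ L = (E - v * F) / (E * F - v) ∧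
    schwarzA ζ α δ L - schwarzB ζ α δ L = (E + v * F) / (E * F + v) ∧
    schwarzA ζ α δ L = F * (E ^ 2 - v ^ 2) / ((E * F) ^ 2 - v ^ 2) := by
  have hδ' : (δ : ℂ) ≠ 0 := by exact_mod_cast hδ.ne'
  have hE0 : E ≠ 0 := hE ▸ Complex.exp_ne_zero _
  have hF' : F = Complex.exp (ζ * L) := by
    rw [hF]; congr 1; push_cast; field_simp
  have hF0 : F ≠ 0 := hF' ▸ Complex.exp_ne_zero _
  have hvs : ζ - α = v * (ζ + α) := by
    rw [hv, cayleyV, ← mul_sub, ← mul_add, mul_div_mul_left _ _ (mul_ne_zero two_ne_zero hδ'),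
      div_mul_cancel₀ _ hα]
  have e1 : Complex.exp (ζ * (2 * δ + L)) = E * F := by
    rw [hE, hF', ← Complex.exp_add]; congr 1; ring
  have e2 : Complex.exp (2 * ζ * δ) = E := by rw [hE]; congr 1; ring
  -- The denominator is a difference of squares in E F and v; one of its two factors cancels in each
  -- of a + b and a - b.
  have hDe : schwarzDenom ζ α δ L = (ζ + α) ^ 2 * ((E * F - v) * (E * F + v)) / (E * F) := by
    rw [schwarzDenom, Complex.exp_neg, e1, hvs]
    field_simp
    ring
  rw [hDe] at hD
  have h12 : (E * F - v) * (E * F + v) ≠ 0 := fun h => hD (by simp [h])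
  have h1 := left_ne_zero_of_mul h12
  have h2 := right_ne_zero_of_mul h12
  have hA : schwarzA ζ α δ L = F * (E ^ 2 - v ^ 2) / ((E * F - v) * (E * F + v)) := by
    rw [schwarzA, hDe, Complex.exp_neg, e2, hvs]
    field_simp
  have hB : schwarzB ζ α δ L = -(v * E * (F ^ 2 - 1)) / ((E * F - v) * (E * F + v)) := by
    rw [schwarzB, hDe, Complex.exp_neg, ← hF',
      show ζ ^ 2 - α ^ 2 = (ζ - α) * (ζ + α) by ring, hvs]
    field_simp
  refine ⟨?_, ?_, ?_⟩
  · rw [hA, hB, ← add_div, div_eq_div_iff h12 h1]; ring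
  · rw [hA, hB, ← sub_div, div_eq_div_iff h12 h2]; ring
  · rw [hA]; congr 1; ring

section ExponentialForm

variable (z : ℂ) (l : ℝ)

lemma normSq_exp (w : ℂ) : Complex.normSq (Complex.exp w) = Real.exp (2 * w.re) := by
  rw [Complex.normSq_eq_norm_sq, Complex.norm_exp, ← Real.exp_nat_mul]
  norm_num

lemma gPM_eq_normSq (s : ℝ) (γ : ℂ) (hs : s ^ 2 = 1) :
    gPM s z γ l = Complex.normSq (Complex.exp z * Complex.exp (l * z) + s * cayleyV z γ)
      - Complex.normSq (Complex.exp z + s * cayleyV z γ * Complex.exp (l * z)) := by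
  have h := normSq_sub_normSq_mul_sub (Complex.exp z) (Complex.exp (l * z)) (-(s * cayleyV z γ))
  have hn : Complex.normSq (-(s * cayleyV z γ)) = ‖cayleyV z γ‖ ^ 2 := by
    rw [Complex.normSq_neg, Complex.normSq_mul, Complex.normSq_ofReal, ← sq, hs, one_mul,
      Complex.normSq_eq_norm_sq]
  rw [hn, normSq_exp, normSq_exp, sub_neg_eq_add, neg_mul, sub_neg_eq_add] at h
  rw [h]
  simp only [gPM, Complex.exp_re, Complex.exp_im, Complex.re_ofReal_mul, Complex.im_ofReal_mul,
    Complex.neg_re, Complex.neg_im]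
  rw [show z.re * (l + 1) = l * z.re + z.re by ring, Real.exp_add, ← mul_assoc 2 l]
  ring

lemma gA_eq_normSq (γ : ℂ) :
    gA z γ l = Complex.normSq ((Complex.exp z * Complex.exp (l * z)) ^ 2 - cayleyV z γ ^ 2)
      - Complex.normSq (Complex.exp (l * z) * (Complex.exp z ^ 2 - cayleyV z γ ^ 2)) := by
  have hEF : Complex.exp z ^ 2 * Complex.exp (l * z) = Complex.exp (((l + 2 : ℝ) : ℂ) * z) := by
    rw [← Complex.exp_nat_mul, ← Complex.exp_add]; congr 1; push_cast; ring
  have hv : Complex.normSq (cayleyV z γ) ^ 2 = ‖cayleyV z γ‖ ^ 4 := by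
    rw [Complex.normSq_eq_norm_sq]; ring
  have he : Real.exp (2 * z.re) ^ 2 * Real.exp (2 * (l * z.re))
      = Real.exp (2 * z.re * (l + 2)) := by
    rw [← Real.exp_nat_mul, ← Real.exp_add]; congr 1; push_cast; ring
  rw [normSq_sub_normSq_sq_sub, hEF, hv, normSq_exp, normSq_exp]
  simp only [gA, Complex.exp_re, Complex.exp_im, Complex.re_ofReal_mul, Complex.im_ofReal_mul]
  rw [he, show 2 * z.re * (l + 1) = l * z.re + (l + 2) * z.re by ring, Real.exp_add,
    ← mul_assoc 2 l, mul_comm z.im (l + 2)]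
  ring

end ExponentialForm

theorem lemma3p3 (a b : ℂ) :
    -- the maximum over the angle, for each choice of the sign
    (∀ s : ℂ, s = 1 ∨ s = -1 →
      IsGreatest
        ((fun θ : ℝ => ‖a * Complex.cos θ
            + s * Complex.sqrt (b ^ 2 - a ^ 2 * Complex.sin θ ^ 2)‖) ''
          Set.Icc (-Real.pi) Real.pi)
        (max ‖a + b‖ ‖a - b‖)) ∧
    -- the limiting spectral radius exists and obeys the bound
    (∃ R : NNReal,
      Tendsto (fun N : ℕ => spectralRadius ℂ (schwarzMatrix a b N)) atTop (𝓝 (R : ENNReal)) ∧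
      (‖a‖ ≤ Real.sqrt ‖a ^ 2 - b ^ 2 / 2‖ → (R : ℝ) ≤ max ‖a + b‖ ‖a - b‖) ∧
      (Real.sqrt ‖a ^ 2 - b ^ 2 / 2‖ < ‖a‖ →
        (R : ℝ) ≤ max (max ‖a + b‖ ‖a - b‖) ‖a‖)) ∧
    -- sufficient conditions, for the coefficients of the Schwarz method
    (∀ (ζ α : ℂ) (δ L : ℝ), 0 < ζ.re → 0 < ζ.im → 0 < δ → 0 < L →
      ζ + α ≠ 0 → schwarzDenom ζ α δ L ≠ 0 →
      a = schwarzA ζ α δ L → b = schwarzB ζ α δ L →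
      (0 < gPM 1 (2 * δ * ζ) (2 * δ * α) (L / (2 * δ)) →
        0 < gPM (-1) (2 * δ * ζ) (2 * δ * α) (L / (2 * δ)) →
          max ‖a + b‖ ‖a - b‖ < 1) ∧
      (0 < gA (2 * δ * ζ) (2 * δ * α) (L / (2 * δ)) → ‖a‖ < 1)) := by
  refine ⟨fun s hs => isGreatest_norm_symbol_eigenvalue a b s hs, ?_, ?_⟩
  · obtain ⟨R, hR, hle⟩ := exists_limit_spectralRadius_schwarzMatrix a b
    exact ⟨R, hR, fun _ => hle, fun _ => hle.trans (le_max_left _ _)⟩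
  · rintro ζ α δ L - - hδ - hα hD rfl rfl
    obtain ⟨hadd, hsub, hA⟩ := schwarz_coefficients (L := L) hδ hα hD rfl rfl rfl
    refine ⟨fun hp hm => max_lt ?_ ?_, fun hg => ?_⟩
    -- The signs cross over: g₋ controls a + b and g₊ controls a - b.
    · rw [gPM_eq_normSq _ _ _ _ (by norm_num)] at hm
      rw [hadd]
      apply norm_div_lt_one_of_normSq_lt
      simpa [← sub_eq_add_neg] using hm
    · rw [gPM_eq_normSq _ _ _ _ (by norm_num)] at hp
      rw [hsub]
      apply norm_div_lt_one_of_normSq_lt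
      simpa using hp
    · rw [gA_eq_normSq] at hg
      rw [hA]
      exact norm_div_lt_one_of_normSq_lt hg
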